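/- Let $\mathcal H,\mathcal K$ be separable complex Hilbert spaces and let $\omega$ be a normal state on $\mathcal B(\mathcal H\otimes\mathcal K)$ with density matrix $\rho$, $\omega(x)=\mathrm{Tr}\,\rho x$, and spectral resolution $\rho=\sum_i\lambda_i|e_i\rangle\langle e_i|$, where $\{e_i\}$ has been completed to a complete orthonormal system of $\mathcal H\otimes\mathcal K$ (so $\lambda_i=0$ is allowed). For a complete orthonormal system $\{f_k\}$ of a Hilbert space, its conjugation is $Jf=\sum_k\overline{(f_k,f)}f_k$, and its transposition is $a^t=Ja^*J$. Let $J_{\mathcal H\otimes\mathcal K}$ be the conjugation of $\{e_i\}$ and let $J_{\mathcal H}$ be the conjugation of a complete orthonormal system $\{h_k\}$ of $\mathcal H$. For $\zeta\in\mathcal H$ let $T_\zeta:\mathcal K\to\mathcal H\otimes\mathcal K$, $T_\zeta\eta=\zeta\otimes\eta$. The entangling operator of $\omega$ is $$H:\mathcal H\to\mathcal H\otimes\mathcal K\otimes\mathcal K,\qquad H\zeta=\sum_i\lambda_i^{1/2}\,J_{\mathcal H\otimes\mathcal K}e_i\otimes T^*_{J_{\mathcal H}\zeta}e_i ,$$ and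 the (Belavkin--Ohya) entanglement mapping of $\omega$ is $$\phi^*:\mathcal B(\mathcal H)\to\mathcal B(\mathcal K)_*,\qquad \phi^*(a)=\mathrm{Tr}_{\mathcal H\otimes\mathcal K}\,H\,(J_{\mathcal H}a^*J_{\mathcal H})\,H^* ,$$ where $\mathcal B(\mathcal K)_*$ is identified with the trace class operators on $\mathcal K$, regarded as elements of $\mathcal B(\mathcal K)$. Let $t$ be the transposition of $\mathcal B(\mathcal H)$ with respect to any complete orthonormal system of $\mathcal H$. The state $\omega$ is called PPT if $\omega\circ(t\otimes\mathrm{id})$ is a state, i.e. if there is a state $\omega'$ on $\mathcal B(\mathcal H\otimes\mathcal K)$ with $\omega'(a\otimes b)=\omega(a^t\otimes b)$ for all $a\in\mathcal B(\mathcal H)$, $b\in\mathcal B(\mathcal K)$. A linear map $\psi:\mathcal B(\mathcal H)\to\mathcal B(\mathcal K)$ is CP if for every $n$ the map $[a_{ij}]\mapsto[\psi(a_{ij})]$ from $M_n(\mathcal B(\mathcal H))$ to $M_n(\mathcal B(\mathcal K))$ is positive, and co-CP if $\psi\circ t$ is CP. Let $\mathcal E_q$ be the set of $q$-entanglements, i.e.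 of the entanglement mappings of normal states on $\mathcal B(\mathcal H\otimes\mathcal K)$ that are not CP. Then: 1. $\omega$ is PPT if and only if $\phi^*$ is both CP and co-CP. 2. $\omega$ is PPT if and only if $\phi^*\notin\mathcal E_q$. -/

import Mathlib

open scoped TensorProduct ComplexOrder CStarAlgebra
open UniformSpace

universe u v w x y

noncomputable section

/-! ### Conjugations, transpositions and Hilbert space tensor products -/

section Basics

variable {E : Type*} [NormedAddCommGroup E] [InnerProductSpace ℂ E]
variable {F : Type*} [NormedAddCommGroup F] [InnerProductSpace ℂ F]

/-- The complex conjugation `J f = ∑ i, conj ⟪e i, f⟫ • e i` attached to a complete orthonormal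
system `e`, as a conjugate-linear isometry. -/
def conjugation {ι : Type*} (e : HilbertBasis ι ℂ E) : E →ₗᵢ⋆[ℂ] E where
  toFun f := e.repr.symm (star (e.repr f))
  map_add' f g := by simp
  map_smul' c f := by simp [star_smul]
  norm_map' f := by simp

/-- The transposition `a ↦ aᵗ = J a* J` of `ℬ(E)` with respect to a complete orthonormal
system `e`. -/
def transposition [CompleteSpace E] {ι : Type*} (e : HilbertBasis ι ℂ E) :
    (E →L[ℂ] E) →ₗ[ℂ] (E →L[ℂ] E) where
  toFun a := ((conjugation e).toContinuousLinearMap.comp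
    (ContinuousLinearMap.adjoint a)).comp (conjugation e).toContinuousLinearMap
  map_add' a b := by ext f; simp
  map_smul' c a := by
    rw [map_smulₛₗ]
    ext f
    simp

/-- The Hilbert space tensor product: the completion of the algebraic tensor product for the
inner product `⟪x ⊗ y, x' ⊗ y'⟫ = ⟪x, x'⟫ ⟪y, y'⟫`. -/
abbrev HilbertTensor (E F : Type*) [NormedAddCommGroup E] [InnerProductSpace ℂ E]
    [NormedAddCommGroup F] [InnerProductSpace ℂ F] : Type _ :=
  Completion (E ⊗[ℂ] F)

/-- The operator `T_ζ : F → E ⊗ F`, `T_ζ η = ζ ⊗ η`. -/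
def tensorLeft (F : Type*) [NormedAddCommGroup F] [InnerProductSpace ℂ F] (ζ : E) :
    F →L[ℂ] HilbertTensor E F :=
  Completion.toComplL.comp (TensorProduct.mkL ℂ E F ζ)

/-- The operator `a ⊗ b` on the Hilbert space tensor product. -/
def tensorOp (a : E →L[ℂ] E) (b : F →L[ℂ] F) : HilbertTensor E F →L[ℂ] HilbertTensor E F :=
  ((Completion.toComplL (𝕜 := ℂ) (E := E ⊗[ℂ] F)).comp (TensorProduct.mapL a b)).extend
    (Completion.toComplL (𝕜 := ℂ) (E := E ⊗[ℂ] F))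

theorem conjugation_basis {ι : Type*} (e : HilbertBasis ι ℂ E) (i : ι) :
    conjugation e (e i) = e i := by
  classical
  change e.repr.symm (star (e.repr (e i))) = e i
  rw [HilbertBasis.repr_self]
  have : star (lp.single 2 i (1 : ℂ) : lp (fun _ : ι => ℂ) 2) = lp.single 2 i (1 : ℂ) := by
    ext j
    by_cases h : j = i
    · subst h; simp
    · simp [h]
  rw [this, HilbertBasis.repr_symm_single]

theorem inner_tensorLeft (x y : E) (f g : F) :
    inner ℂ (tensorLeft F x f) (tensorLeft F y g) = inner ℂ x y * inner ℂ f g := by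
  simp [tensorLeft]

theorem norm_tensorLeft (x : E) (f : F) : ‖tensorLeft F x f‖ = ‖x‖ * ‖f‖ := by
  simp [tensorLeft]

theorem tensorOp_tensorLeft (a : E →L[ℂ] E) (b : F →L[ℂ] F) (x : E) (f : F) :
    tensorOp a b (tensorLeft F x f) = tensorLeft F (a x) (b f) := by
  have h := ContinuousLinearMap.extend_eq
    ((Completion.toComplL (𝕜 := ℂ) (E := E ⊗[ℂ] F)).comp (TensorProduct.mapL a b))
    (e := Completion.toComplL (𝕜 := ℂ) (E := E ⊗[ℂ] F))
    Completion.denseRange_coe (Completion.isUniformInducing_coe _) (x ⊗ₜ f)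
  simpa [tensorOp, tensorLeft] using h

theorem tensorLeft_add (x y : E) : tensorLeft F (x + y) = tensorLeft F x + tensorLeft F y := by
  simp [tensorLeft]

theorem tensorLeft_smul (c : ℂ) (x : E) : tensorLeft F (c • x) = c • tensorLeft F x := by
  simp [tensorLeft]

variable [CompleteSpace F]

theorem adjoint_tensorLeft_tensorLeft (x y : E) (f : F) :
    ContinuousLinearMap.adjoint (tensorLeft F x) (tensorLeft F y f) = inner ℂ x y • f := by
  refine ext_inner_left ℂ fun g => ?_
  rw [ContinuousLinearMap.adjoint_inner_right, inner_tensorLeft, inner_smul_right]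

theorem norm_adjoint_tensorLeft_le (x : E) (z : HilbertTensor E F) :
    ‖ContinuousLinearMap.adjoint (tensorLeft F x) z‖ ≤ ‖x‖ * ‖z‖ := by
  refine (ContinuousLinearMap.le_opNorm _ _).trans ?_
  gcongr
  rw [LinearIsometryEquiv.norm_map]
  exact ContinuousLinearMap.opNorm_le_bound _ (norm_nonneg _) fun f => (norm_tensorLeft x f).le

/-- The partial trace over the first factor: `⟪g, (Tr_E S) f⟫ = ∑ i, ⟪e i ⊗ g, S (e i ⊗ f)⟫`,
that is `Tr_E S = ∑ i, T_{e i}* S T_{e i}`, computed in a complete orthonormal system `e` of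
`E`. For the trace class operators to which it is applied below the series converges in
operator norm, and its sum does not depend on `e`. -/
def partialTrace {ι : Type*} (e : HilbertBasis ι ℂ E)
    (S : HilbertTensor E F →L[ℂ] HilbertTensor E F) : F →L[ℂ] F :=
  ∑' i, ((ContinuousLinearMap.adjoint (tensorLeft F (e i))).comp S).comp (tensorLeft F (e i))

end Basics

/-! ### Normal states -/

section States

variable {E : Type*} [NormedAddCommGroup E] [InnerProductSpace ℂ E] [CompleteSpace E]

/-- A state on `ℬ(E)`: a positive linear functional with `ω 1 = 1`. -/
structure IsState (ω : (E →L[ℂ] E) →ₗ[ℂ] ℂ) : Prop where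
  map_one : ω 1 = 1
  map_nonneg : ∀ a : E →L[ℂ] E, 0 ≤ a → 0 ≤ ω a

/-- A normal state: a state that preserves suprema of upward directed sets. -/
structure IsNormalState (ω : (E →L[ℂ] E) →ₗ[ℂ] ℂ) : Prop extends IsState ω where
  normal : ∀ D : Set (E →L[ℂ] E), D.Nonempty → DirectedOn (· ≤ ·) D →
    ∀ s, IsLUB D s → IsLUB (ω '' D) (ω s)

/-- The density matrix `ρ` of `ω`, so that `ω x = Tr (ρ x)`, with a spectral resolution
`ρ = ∑ i, λ i |e i⟩⟨e i|`, where the eigenvectors have been completed to a complete orthonormal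
system (eigenvalues `λ i = 0` are allowed). The trace is computed in the basis `e`. -/
structure SpectralResolution (ω : (E →L[ℂ] E) →ₗ[ℂ] ℂ) (ι : Type*) where
  density : E →L[ℂ] E
  basis : HilbertBasis ι ℂ E
  eigenvalue : ι → ℝ
  eigenvalue_nonneg : ∀ i, 0 ≤ eigenvalue i
  hasSum_eigenvalue : HasSum eigenvalue 1
  density_basis : ∀ i, density (basis i) = (eigenvalue i : ℂ) • basis i
  hasSum_trace : ∀ a : E →L[ℂ] E,
    HasSum (fun i => inner ℂ (basis i) (density (a (basis i)))) (ω a)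

end States

/-! ### The entangling operator and the entanglement mapping -/

section Entanglement

variable {H : Type*} [NormedAddCommGroup H] [InnerProductSpace ℂ H]
variable {K : Type*} [NormedAddCommGroup K] [InnerProductSpace ℂ K] [CompleteSpace K]
variable {ω : (HilbertTensor H K →L[ℂ] HilbertTensor H K) →ₗ[ℂ] ℂ} {ι κ : Type*}

/-- The terms `√(λ i) • (J_{H ⊗ K} e i ⊗ T_{J_H ζ}* e i)` of the series that defines the
entangling operator. -/
def entanglingTerm (R : SpectralResolution ω ι) (h : HilbertBasis κ ℂ H) (ζ : H) (i : ι) :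
    HilbertTensor (HilbertTensor H K) K :=
  (Real.sqrt (R.eigenvalue i) : ℂ) •
    tensorLeft K (conjugation R.basis (R.basis i))
      (ContinuousLinearMap.adjoint (tensorLeft K (conjugation h ζ)) (R.basis i))

theorem norm_entanglingTerm_sq_le (R : SpectralResolution ω ι) (h : HilbertBasis κ ℂ H) (ζ : H)
    (i : ι) : ‖entanglingTerm R h ζ i‖ ^ 2 ≤ R.eigenvalue i * ‖ζ‖ ^ 2 := by
  have h1 : ‖R.basis i‖ = 1 := R.basis.orthonormal.1 i
  have h2 := norm_adjoint_tensorLeft_le (F := K) (conjugation h ζ) (R.basis i)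
  rw [h1, mul_one, LinearIsometry.norm_map] at h2
  rw [entanglingTerm, norm_smul, norm_tensorLeft, LinearIsometry.norm_map, h1, one_mul, mul_pow]
  rw [Complex.norm_real, Real.norm_eq_abs, sq_abs, Real.sq_sqrt (R.eigenvalue_nonneg i)]
  gcongr
  exact R.eigenvalue_nonneg i

theorem inner_entanglingTerm (R : SpectralResolution ω ι) (h : HilbertBasis κ ℂ H) (ζ : H)
    {i j : ι} (hij : i ≠ j) :
    inner ℂ (entanglingTerm R h ζ i) (entanglingTerm R h ζ j) = 0 := by
  rw [entanglingTerm, entanglingTerm, inner_smul_left, inner_smul_right, inner_tensorLeft,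
    conjugation_basis, conjugation_basis, R.basis.orthonormal.2 hij]
  simp

theorem norm_sum_entanglingTerm_sq (R : SpectralResolution ω ι) (h : HilbertBasis κ ℂ H) (ζ : H)
    (s : Finset ι) :
    ‖∑ i ∈ s, entanglingTerm R h ζ i‖ ^ 2 = ∑ i ∈ s, ‖entanglingTerm R h ζ i‖ ^ 2 := by
  classical
  induction s using Finset.induction_on with
  | empty => simp
  | insert a s ha ih =>
    rw [Finset.sum_insert ha, Finset.sum_insert ha, ← ih, sq, sq, sq]
    refine norm_add_sq_eq_norm_sq_add_norm_sq_of_inner_eq_zero (𝕜 := ℂ) _ _ ?_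
    rw [inner_sum]
    exact Finset.sum_eq_zero fun j hj =>
      inner_entanglingTerm R h ζ (fun hh => ha (hh ▸ hj))

theorem norm_sum_entanglingTerm_sq_le (R : SpectralResolution ω ι) (h : HilbertBasis κ ℂ H)
    (ζ : H) (s : Finset ι) :
    ‖∑ i ∈ s, entanglingTerm R h ζ i‖ ^ 2 ≤ (∑ i ∈ s, R.eigenvalue i) * ‖ζ‖ ^ 2 := by
  rw [norm_sum_entanglingTerm_sq, Finset.sum_mul]
  exact Finset.sum_le_sum fun i _ => norm_entanglingTerm_sq_le R h ζ i

theorem summable_entanglingTerm (R : SpectralResolution ω ι) (h : HilbertBasis κ ℂ H) (ζ : H) :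
    Summable (entanglingTerm R h ζ) := by
  rw [summable_iff_vanishing_norm]
  intro ε hε
  obtain ⟨s, hs⟩ := summable_iff_vanishing_norm.1
    (R.hasSum_eigenvalue.summable.mul_right (‖ζ‖ ^ 2)) (ε ^ 2) (by positivity)
  refine ⟨s, fun t ht => ?_⟩
  have h1 := hs t ht
  rw [← Finset.sum_mul] at h1
  have h2 := norm_sum_entanglingTerm_sq_le R h ζ t
  exact lt_of_pow_lt_pow_left₀ 2 hε.le (h2.trans_lt ((le_abs_self _).trans_lt h1))

theorem norm_tsum_entanglingTerm_le (R : SpectralResolution ω ι) (h : HilbertBasis κ ℂ H)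
    (ζ : H) : ‖∑' i, entanglingTerm R h ζ i‖ ≤ ‖ζ‖ := by
  refine le_of_tendsto (summable_entanglingTerm R h ζ).hasSum.norm
    (Filter.Eventually.of_forall fun s => ?_)
  have h1 := norm_sum_entanglingTerm_sq_le R h ζ s
  have h2 : ∑ i ∈ s, R.eigenvalue i ≤ 1 :=
    sum_le_hasSum s (fun i _ => R.eigenvalue_nonneg i) R.hasSum_eigenvalue
  have h3 : (∑ i ∈ s, R.eigenvalue i) * ‖ζ‖ ^ 2 ≤ 1 * ‖ζ‖ ^ 2 := by gcongr
  exact le_of_sq_le_sq (by linarith) (norm_nonneg _)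

/-- The entangling operator `V : H → H ⊗ K ⊗ K`,
`V ζ = ∑ i, √(λ i) • (J_{H ⊗ K} ⊗ T_{J_H ζ}*) (e i ⊗ e i)`, where `J_{H ⊗ K}` is the conjugation
attached to the eigenbasis `e` of the density matrix and `J_H` the one attached to `h`. -/
def entanglingOperator (R : SpectralResolution ω ι) (h : HilbertBasis κ ℂ H) :
    H →L[ℂ] HilbertTensor (HilbertTensor H K) K :=
  LinearMap.mkContinuous
    { toFun := fun ζ => ∑' i, entanglingTerm R h ζ i
      map_add' := fun ζ ξ => by
        rw [← (summable_entanglingTerm R h ζ).tsum_add (summable_entanglingTerm R h ξ)]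
        congr 1
        ext i : 1
        simp [entanglingTerm, tensorLeft_add]
      map_smul' := fun c ζ => by
        rw [RingHom.id_apply, ← (summable_entanglingTerm R h ζ).tsum_const_smul c]
        congr 1
        ext i : 1
        simp only [entanglingTerm, map_smulₛₗ, tensorLeft_smul,
          _root_.smul_apply, RingHomCompTriple.comp_apply, RingHom.id_apply]
        rw [smul_comm c] }
    1 fun ζ => by simpa using norm_tsum_entanglingTerm_le R h ζ

theorem adjoint_tensorLeft_entanglingOperator (R : SpectralResolution ω ι)
    (h : HilbertBasis κ ℂ H) (i : ι) (ζ : H) :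
    ContinuousLinearMap.adjoint (tensorLeft K (R.basis i)) (entanglingOperator R h ζ) =
      (Real.sqrt (R.eigenvalue i) : ℂ) •
        ContinuousLinearMap.adjoint (tensorLeft K (conjugation h ζ)) (R.basis i) := by
  classical
  change ContinuousLinearMap.adjoint (tensorLeft K (R.basis i))
    (∑' j, entanglingTerm R h ζ j) = _
  rw [ContinuousLinearMap.map_tsum _ (summable_entanglingTerm R h ζ), tsum_eq_single i]
  · rw [entanglingTerm, map_smul, conjugation_basis, adjoint_tensorLeft_tensorLeft,
      inner_self_eq_norm_sq_to_K, R.basis.orthonormal.1 i]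
    simp
  · intro j hj
    rw [entanglingTerm, map_smul, conjugation_basis, adjoint_tensorLeft_tensorLeft,
      R.basis.orthonormal.2 hj.symm]
    simp

theorem norm_adjoint_tensorLeft_comp_entanglingOperator_le (R : SpectralResolution ω ι)
    (h : HilbertBasis κ ℂ H) (i : ι) :
    ‖(ContinuousLinearMap.adjoint (tensorLeft K (R.basis i))).comp (entanglingOperator R h)‖ ≤
      Real.sqrt (R.eigenvalue i) := by
  refine ContinuousLinearMap.opNorm_le_bound _ (Real.sqrt_nonneg _) fun ζ => ?_
  have h2 := norm_adjoint_tensorLeft_le (F := K) (conjugation h ζ) (R.basis i)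
  rw [R.basis.orthonormal.1 i, mul_one, LinearIsometry.norm_map] at h2
  rw [ContinuousLinearMap.comp_apply, adjoint_tensorLeft_entanglingOperator, norm_smul,
    Complex.norm_real, Real.norm_eq_abs, abs_of_nonneg (Real.sqrt_nonneg _)]
  gcongr

variable [CompleteSpace H]

/-- The series for the partial trace of `V c V*` converges in operator norm. -/
theorem summable_partialTrace (R : SpectralResolution ω ι) (h : HilbertBasis κ ℂ H)
    (c : H →L[ℂ] H) :
    Summable fun i => ((ContinuousLinearMap.adjoint (tensorLeft K (R.basis i))).comp
      ((entanglingOperator R h).comp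
        (c.comp (ContinuousLinearMap.adjoint (entanglingOperator R h))))).comp
          (tensorLeft K (R.basis i)) := by
  refine Summable.of_norm_bounded (R.hasSum_eigenvalue.summable.mul_left ‖c‖) fun i => ?_
  set A := (ContinuousLinearMap.adjoint (tensorLeft K (R.basis i))).comp (entanglingOperator R h)
    with hA
  have h1 : ‖A‖ ≤ Real.sqrt (R.eigenvalue i) :=
    norm_adjoint_tensorLeft_comp_entanglingOperator_le R h i
  have h2 : ContinuousLinearMap.adjoint A =
      (ContinuousLinearMap.adjoint (entanglingOperator R h)).comp (tensorLeft K (R.basis i)) := by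
    rw [hA, ContinuousLinearMap.adjoint_comp, ContinuousLinearMap.adjoint_adjoint]
  have h3 : ‖ContinuousLinearMap.adjoint A‖ = ‖A‖ := LinearIsometryEquiv.norm_map _ _
  change ‖A.comp (c.comp ((ContinuousLinearMap.adjoint (entanglingOperator R h)).comp
    (tensorLeft K (R.basis i))))‖ ≤ _
  rw [← h2]
  calc _ ≤ ‖A‖ * (‖c‖ * ‖ContinuousLinearMap.adjoint A‖) :=
        (ContinuousLinearMap.opNorm_comp_le _ _).trans
          (mul_le_mul_of_nonneg_left (ContinuousLinearMap.opNorm_comp_le _ _) (norm_nonneg _))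
    _ = ‖c‖ * (‖A‖ * ‖A‖) := by rw [h3]; ring
    _ ≤ ‖c‖ * (Real.sqrt (R.eigenvalue i) * Real.sqrt (R.eigenvalue i)) := by gcongr
    _ = ‖c‖ * R.eigenvalue i := by rw [Real.mul_self_sqrt (R.eigenvalue_nonneg i)]

/-- The entanglement mapping `φ* : ℬ(H) → ℬ(K)_*`, `φ*(a) = Tr_{H ⊗ K} V aᵗ V*`, with
`aᵗ = J_H a* J_H`. The predual `ℬ(K)_*` is identified with the trace class operators on `K`, and
the mapping is recorded with values in `ℬ(K)`. -/
def entanglementMapping (R : SpectralResolution ω ι) (h : HilbertBasis κ ℂ H) :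
    (H →L[ℂ] H) →ₗ[ℂ] (K →L[ℂ] K) where
  toFun a := partialTrace R.basis ((entanglingOperator R h).comp
    ((transposition h a).comp (ContinuousLinearMap.adjoint (entanglingOperator R h))))
  map_add' a b := by
    unfold partialTrace
    rw [← (summable_partialTrace R h (transposition h a)).tsum_add
      (summable_partialTrace R h (transposition h b))]
    congr 1
    ext i f : 2
    simp
  map_smul' c a := by
    unfold partialTrace
    rw [RingHom.id_apply,
      ← (summable_partialTrace R h (transposition h a)).tsum_const_smul c]
    congr 1
    ext i f : 2
    simp

/-- Complete positivity: `ψ` underlies a completely positive map, i.e. for every `n` the map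
`[a i j] ↦ [ψ (a i j)]` from `M_n(ℬ(H))` to `M_n(ℬ(K))` is positive. -/
def IsCP (ψ : (H →L[ℂ] H) →ₗ[ℂ] (K →L[ℂ] K)) : Prop :=
  ∃ Ψ : (H →L[ℂ] H) →CP (K →L[ℂ] K), Ψ.toLinearMap = ψ

/-- Complete co-positivity: the composition with the transposition is completely positive. -/
def IsCoCP {τ : Type*} (t : HilbertBasis τ ℂ H) (ψ : (H →L[ℂ] H) →ₗ[ℂ] (K →L[ℂ] K)) : Prop :=
  IsCP (ψ ∘ₗ transposition t)

/-- PPT states: `ω` is a state and `ω ∘ (t ⊗ id)` is a state. As `t ⊗ id` is in general only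
defined on the algebraic tensor product `ℬ(H) ⊙ ℬ(K)`, the latter means that the functional
`a ⊗ b ↦ ω (aᵗ ⊗ b)` is the restriction of a state. -/
def IsPPT {τ : Type*} (t : HilbertBasis τ ℂ H)
    (ω : (HilbertTensor H K →L[ℂ] HilbertTensor H K) →ₗ[ℂ] ℂ) : Prop :=
  IsState ω ∧ ∃ ω' : (HilbertTensor H K →L[ℂ] HilbertTensor H K) →ₗ[ℂ] ℂ, IsState ω' ∧
    ∀ (a : H →L[ℂ] H) (b : K →L[ℂ] K), ω' (tensorOp a b) = ω (tensorOp (transposition t a) b)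

end Entanglement

/-- The set of all entanglement mappings of normal states on `ℬ(H ⊗ K)`. -/
def entanglementMappings (H : Type u) [NormedAddCommGroup H] [InnerProductSpace ℂ H]
    [CompleteSpace H] (K : Type v) [NormedAddCommGroup K] [InnerProductSpace ℂ K]
    [CompleteSpace K] : Set ((H →L[ℂ] H) →ₗ[ℂ] (K →L[ℂ] K)) :=
  {ψ | ∃ (ω : (HilbertTensor H K →L[ℂ] HilbertTensor H K) →ₗ[ℂ] ℂ) (_ : IsNormalState ω)
    (ι : Type w) (R : SpectralResolution ω ι) (κ : Type x) (h : HilbertBasis κ ℂ H),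
    ψ = entanglementMapping R h}

/-- The set `ℰ_q` of all `q`-entanglements: the entanglement mappings that are not completely
positive. -/
def qEntanglements (H : Type u) [NormedAddCommGroup H] [InnerProductSpace ℂ H]
    [CompleteSpace H] (K : Type v) [NormedAddCommGroup K] [InnerProductSpace ℂ K]
    [CompleteSpace K] : Set ((H →L[ℂ] H) →ₗ[ℂ] (K →L[ℂ] K)) :=
  {ψ | ψ ∈ entanglementMappings.{u, v, w, x} H K ∧ ¬ IsCP ψ}

end

/-! Everything rests on the duality `inner_entanglementMapping`: ⟨g, φ*(a) f⟩ = ω(a ⊗ |f⟩⟨g|).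
Positivity of matrices of values of φ* thereby becomes positivity of ω on sums of elementary
tensors.

Tested on [aᵢ* aⱼ], the map φ* ∘ t produces ω(XX*) for an explicit X, so φ* is co-CP for every state
(`isCoCP_entanglementMapping`). Both claims therefore reduce to: ω is PPT iff φ* is CP. If ω ∘ (t ⊗
id) extends to a state ω', the same computation with ω' in place of ω gives CP
(`IsPPT.isCP_entanglementMapping`).

Conversely, CP of φ* says that ω is nonnegative on partial transposes of rank one positive
operators. Since ω is a convergent sum of vector functionals, this extends to partial transposes of
compressions of any positive operator (`IsCP.partialTranspose_nonneg`). On a ⊗ b these positive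
functionals converge to ω(aᵗ ⊗ b) as the compressions grow, and a weak-* cluster point is the
required state (`IsCP.isPPT`). -/

noncomputable section

/-! ### Algebra of the operators a ⊗ b on the Hilbert tensor product. -/

section TensorAlgebra

open ContinuousLinearMap InnerProductSpace

variable {E : Type*} [NormedAddCommGroup E] [InnerProductSpace ℂ E]
variable {F : Type*} [NormedAddCommGroup F] [InnerProductSpace ℂ F]

/-- A property of vectors of the Hilbert tensor product that is closed, additive, and holds for
elementary tensors, holds everywhere. -/
theorem HilbertTensor.induction {p : HilbertTensor E F → Prop}
    (hc : IsClosed {z | p z}) (hadd : ∀ y z, p y → p z → p (y + z))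
    (ht : ∀ x f, p (tensorLeft F x f)) (z : HilbertTensor E F) : p z := by
  induction z using Completion.induction_on with
  | hp => exact hc
  | ih z =>
    induction z using TensorProduct.induction_on with
    | zero => rw [← TensorProduct.zero_tmul E (0 : F)]; exact ht 0 0
    | tmul x f => exact ht x f
    | add y z hy hz => rw [Completion.coe_add]; exact hadd _ _ hy hz

theorem HilbertTensor.clm_ext {G : Type*} [NormedAddCommGroup G] [NormedSpace ℂ G]
    {S T : HilbertTensor E F →L[ℂ] G}
    (hST : ∀ x f, S (tensorLeft F x f) = T (tensorLeft F x f)) : S = T := by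
  ext z
  refine HilbertTensor.induction (p := fun z => S z = T z)
    (isClosed_eq S.continuous T.continuous) (fun y z hy hz => ?_) hST z
  rw [map_add, map_add, hy, hz]

theorem tensorOp_mul (a a' : E →L[ℂ] E) (b b' : F →L[ℂ] F) :
    tensorOp a b * tensorOp a' b' = tensorOp (a * a') (b * b') :=
  HilbertTensor.clm_ext fun x f => by simp [tensorOp_tensorLeft]

theorem tensorOp_add_left (a a' : E →L[ℂ] E) (b : F →L[ℂ] F) :
    tensorOp (a + a') b = tensorOp a b + tensorOp a' b :=
  HilbertTensor.clm_ext fun x f => by simp [tensorOp_tensorLeft, tensorLeft_add]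

theorem tensorOp_smul_left (c : ℂ) (a : E →L[ℂ] E) (b : F →L[ℂ] F) :
    tensorOp (c • a) b = c • tensorOp a b :=
  HilbertTensor.clm_ext fun x f => by simp [tensorOp_tensorLeft, tensorLeft_smul]

theorem tensorOp_add_right (a : E →L[ℂ] E) (b b' : F →L[ℂ] F) :
    tensorOp a (b + b') = tensorOp a b + tensorOp a b' :=
  HilbertTensor.clm_ext fun x f => by simp [tensorOp_tensorLeft]

theorem tensorOp_smul_right (c : ℂ) (a : E →L[ℂ] E) (b : F →L[ℂ] F) :
    tensorOp a (c • b) = c • tensorOp a b :=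
  HilbertTensor.clm_ext fun x f => by simp [tensorOp_tensorLeft]

theorem tensorOp_one : tensorOp (1 : E →L[ℂ] E) (1 : F →L[ℂ] F) = 1 :=
  HilbertTensor.clm_ext fun x f => by simp [tensorOp_tensorLeft]

theorem tensorOp_sum_left {α : Type*} (s : Finset α) (a : α → E →L[ℂ] E) (b : F →L[ℂ] F) :
    tensorOp (∑ i ∈ s, a i) b = ∑ i ∈ s, tensorOp (a i) b :=
  map_sum (AddMonoidHom.mk' (fun a : E →L[ℂ] E => tensorOp a b)
    fun a a' => tensorOp_add_left a a' b) a s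

theorem star_tensorOp [CompleteSpace E] [CompleteSpace F] (a : E →L[ℂ] E) (b : F →L[ℂ] F) :
    star (tensorOp a b) = tensorOp (star a) (star b) := by
  refine HilbertTensor.clm_ext fun x f => ext_inner_right ℂ fun z => ?_
  rw [star_eq_adjoint, adjoint_inner_left]
  refine HilbertTensor.induction (p := fun z =>
      inner ℂ (tensorLeft F x f) (tensorOp a b z) =
        inner ℂ (tensorOp (star a) (star b) (tensorLeft F x f)) z)
    (isClosed_eq (by fun_prop) (by fun_prop)) (fun y z hy hz => ?_) (fun y g => ?_) z
  · rw [map_add, inner_add_right, inner_add_right, hy, hz]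
  · rw [tensorOp_tensorLeft, tensorOp_tensorLeft, inner_tensorLeft, inner_tensorLeft,
      star_eq_adjoint, star_eq_adjoint, adjoint_inner_left, adjoint_inner_left]

/-- The operator `E → E ⊗ F`, `ζ ↦ ζ ⊗ f`. -/
def tensorRight (E : Type*) [NormedAddCommGroup E] [InnerProductSpace ℂ E] (f : F) :
    E →L[ℂ] HilbertTensor E F :=
  LinearMap.mkContinuous
    { toFun := fun x => tensorLeft F x f
      map_add' := fun x y => by simp [tensorLeft_add]
      map_smul' := fun c x => by simp [tensorLeft_smul] }
    ‖f‖ fun x => by simp [norm_tensorLeft, mul_comm]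

@[simp] theorem tensorRight_apply (f : F) (x : E) : tensorRight E f x = tensorLeft F x f := rfl

theorem adjoint_tensorRight_tensorLeft [CompleteSpace E] (g : F) (x : E) (f : F) :
    adjoint (tensorRight E g) (tensorLeft F x f) = inner ℂ g f • x := by
  refine ext_inner_left ℂ fun y => ?_
  rw [adjoint_inner_right, tensorRight_apply, inner_tensorLeft, inner_smul_right, mul_comm]

theorem tensorOp_rankOne [CompleteSpace E] (a : E →L[ℂ] E) (f g : F) :
    tensorOp a (rankOne ℂ f g) = tensorRight E f ∘L a ∘L adjoint (tensorRight E g) :=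
  HilbertTensor.clm_ext fun x k => by
    simp [tensorOp_tensorLeft, adjoint_tensorRight_tensorLeft]

theorem adjoint_tensorLeft_tensorOp_tensorLeft [CompleteSpace F] (a : E →L[ℂ] E) (b : F →L[ℂ] F)
    (x y : E) :
    adjoint (tensorLeft F x) ∘L tensorOp a b ∘L tensorLeft F y = inner ℂ x (a y) • b := by
  ext f
  simp [tensorOp_tensorLeft, adjoint_tensorLeft_tensorLeft]

theorem tensorOp_rankOne_left [CompleteSpace F] (x y : E) (b : F →L[ℂ] F) :
    tensorOp (rankOne ℂ x y) b = tensorLeft F x ∘L b ∘L adjoint (tensorLeft F y) :=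
  HilbertTensor.clm_ext fun z f => by
    simp [tensorOp_tensorLeft, adjoint_tensorLeft_tensorLeft, tensorLeft_smul]

end TensorAlgebra

/-! ### The transposition is a *-preserving involutive anti-automorphism. -/

section Transposition

open ContinuousLinearMap InnerProductSpace

variable {E : Type*} [NormedAddCommGroup E] [InnerProductSpace ℂ E]

theorem conjugation_conjugation {ι : Type*} (e : HilbertBasis ι ℂ E) (f : E) :
    conjugation e (conjugation e f) = f := by
  change e.repr.symm (star (e.repr (e.repr.symm (star (e.repr f))))) = f
  simp

theorem inner_conjugation_conjugation {ι : Type*} (e : HilbertBasis ι ℂ E) (f g : E) :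
    inner ℂ (conjugation e f) (conjugation e g) = inner ℂ g f := by
  change inner ℂ (e.repr.symm (star (e.repr f))) (e.repr.symm (star (e.repr g))) = _
  rw [LinearIsometryEquiv.inner_map_map, ← e.repr.inner_map_map g f, lp.inner_eq_tsum,
    lp.inner_eq_tsum]
  simp [mul_comm]

theorem inner_conjugation_left {ι : Type*} (e : HilbertBasis ι ℂ E) (f g : E) :
    inner ℂ (conjugation e f) g = inner ℂ (conjugation e g) f := by
  rw [← inner_conjugation_conjugation e, conjugation_conjugation]

theorem inner_conjugation_right {ι : Type*} (e : HilbertBasis ι ℂ E) (f g : E) :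
    inner ℂ f (conjugation e g) = inner ℂ g (conjugation e f) := by
  rw [← inner_conj_symm, inner_conjugation_left, inner_conj_symm]

variable [CompleteSpace E] {ι : Type*} (e : HilbertBasis ι ℂ E)

theorem transposition_apply (a : E →L[ℂ] E) (f : E) :
    transposition e a f = conjugation e (adjoint a (conjugation e f)) := rfl

theorem transposition_star (a : E →L[ℂ] E) :
    transposition e (star a) = star (transposition e a) := by
  ext f
  refine ext_inner_right ℂ fun g => ?_
  rw [star_eq_adjoint, star_eq_adjoint, adjoint_inner_left, transposition_apply,
    transposition_apply, adjoint_adjoint, inner_conjugation_left, inner_conjugation_right,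
    ← adjoint_inner_left, ← inner_conj_symm, inner_conjugation_left]

theorem transposition_transposition (a : E →L[ℂ] E) :
    transposition e (transposition e a) = a := by
  ext f
  rw [transposition_apply, ← star_eq_adjoint, ← transposition_star, transposition_apply,
    star_eq_adjoint, adjoint_adjoint, conjugation_conjugation, conjugation_conjugation]

theorem transposition_mul (a b : E →L[ℂ] E) :
    transposition e (a * b) = transposition e b * transposition e a := by
  ext f
  rw [mul_apply_eq_comp, transposition_apply, transposition_apply, transposition_apply,
    conjugation_conjugation, mul_def, adjoint_comp, comp_apply]

end Transposition

/-! ### Positivity in C*-algebras and in matrices of operators. -/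

section CStarAlgebra

variable {A : Type*} [NonUnitalCStarAlgebra A] [PartialOrder A] [StarOrderedRing A]

theorem exists_eq_star_mul_self_of_nonneg {a : A} (ha : 0 ≤ a) : ∃ b : A, a = star b * b :=
  CStarAlgebra.nonneg_iff_eq_star_mul_self.1 ha

/-- The witness is the negative part: a⁻a⁺ = 0 gives a⁻a = -(a⁻)². It serves to pass from
nonnegative quadratic forms to positivity in the C*-algebra. -/
theorem exists_nonneg_mul_mul_eq_neg {a : A} (ha : IsSelfAdjoint a) :
    ∃ b : A, 0 ≤ b ∧ b * a * b = -(b * b * b) ∧ (b = 0 → 0 ≤ a) := by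
  refine ⟨a⁻, CFC.negPart_nonneg a, ?_, fun h => (CFC.negPart_eq_zero_iff a ha).1 h⟩
  have h : a⁻ * a = -(a⁻ * a⁻) := by
    calc a⁻ * a = a⁻ * (a⁺ - a⁻) := by rw [CFC.posPart_sub_negPart a ha]
      _ = -(a⁻ * a⁻) := by rw [mul_sub, CFC.negPart_mul_posPart, zero_sub]
  rw [h, neg_mul]

end CStarAlgebra

section CStarMatrixPositivity

variable {K : Type*} [NormedAddCommGroup K] [InnerProductSpace ℂ K]
variable {n : Type*} [Fintype n]

namespace CStarMatrix

/-- The operator on the Hilbert sum `Kⁿ` given by a matrix of operators on `K`. -/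
def toPiLp (M : CStarMatrix n n (K →L[ℂ] K)) :
    PiLp 2 (fun _ : n => K) →ₗ[ℂ] PiLp 2 (fun _ : n => K) where
  toFun v := WithLp.toLp 2 fun i => ∑ j, M i j (v j)
  map_add' v w := by ext i; simp [Finset.sum_add_distrib]
  map_smul' c v := by ext i; simp [Finset.smul_sum]

theorem toPiLp_apply (M : CStarMatrix n n (K →L[ℂ] K)) (v : PiLp 2 (fun _ : n => K)) (i : n) :
    M.toPiLp v i = ∑ j, M i j (v j) := rfl

theorem inner_toPiLp (M : CStarMatrix n n (K →L[ℂ] K)) (v w : PiLp 2 (fun _ : n => K)) :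
    inner ℂ v (M.toPiLp w) = ∑ i, ∑ j, inner ℂ (v i) (M i j (w j)) := by
  simp [PiLp.inner_apply, toPiLp_apply, inner_sum]

theorem toPiLp_mul (M N : CStarMatrix n n (K →L[ℂ] K)) (v : PiLp 2 (fun _ : n => K)) :
    (M * N).toPiLp v = M.toPiLp (N.toPiLp v) := by
  ext i
  simp only [toPiLp_apply, mul_apply, map_sum, sum_apply,
    mul_apply_eq_comp]
  exact Finset.sum_comm

theorem toPiLp_injective :
    Function.Injective (toPiLp : CStarMatrix n n (K →L[ℂ] K) → _) := by
  classical
  intro M N hMN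
  ext i j f
  have := congrArg (fun v : PiLp 2 (fun _ : n => K) => v i)
    (LinearMap.congr_fun hMN (WithLp.toLp 2 (Pi.single j f)))
  simpa [toPiLp_apply, Pi.single_apply, apply_ite] using this

variable [CompleteSpace K]

theorem inner_toPiLp_star (M : CStarMatrix n n (K →L[ℂ] K)) (v w : PiLp 2 (fun _ : n => K)) :
    inner ℂ ((star M).toPiLp v) w = inner ℂ v (M.toPiLp w) := by
  rw [inner_toPiLp, ← inner_conj_symm, inner_toPiLp, map_sum, Finset.sum_comm]
  simp [star_apply, ContinuousLinearMap.star_eq_adjoint,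
    ContinuousLinearMap.adjoint_inner_right]

theorem inner_toPiLp_nonneg {M : CStarMatrix n n (K →L[ℂ] K)} (hM : 0 ≤ M)
    (v : PiLp 2 (fun _ : n => K)) : 0 ≤ inner ℂ v (M.toPiLp v) := by
  obtain ⟨X, rfl⟩ := exists_eq_star_mul_self_of_nonneg hM
  rw [toPiLp_mul, ← inner_toPiLp_star, star_star, inner_self_eq_norm_sq_to_K]
  positivity

/-- A form with real values is symmetric, so M is self-adjoint. With N its negative part, the form
of N³ is nonnegative because N ≥ 0, and nonpositive because -N³ = NMN; hence N³ = 0 and N = 0. -/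
theorem nonneg_of_inner_toPiLp_nonneg {M : CStarMatrix n n (K →L[ℂ] K)}
    (hM : ∀ v, 0 ≤ inner ℂ v (M.toPiLp v)) : 0 ≤ M := by
  have hsymm : M.toPiLp.IsSymmetric := by
    rw [LinearMap.isSymmetric_iff_inner_map_self_real]
    intro v
    rw [inner_conj_symm, ← inner_conj_symm (M.toPiLp v) v]
    exact (Complex.conj_eq_iff_im.2 (Complex.nonneg_iff.1 (hM v)).2.symm).symm
  have hsa : IsSelfAdjoint M := toPiLp_injective <| LinearMap.ext fun v =>
    ext_inner_right ℂ fun w => by rw [inner_toPiLp_star, hsymm v w]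
  obtain ⟨N, hN, hNMN, hN0⟩ := exists_nonneg_mul_mul_eq_neg hsa
  have hNs : star N = N := IsSelfAdjoint.of_nonneg hN
  have hmid : ∀ (X : CStarMatrix n n (K →L[ℂ] K)) (v : PiLp 2 (fun _ : n => K)),
      inner ℂ v ((N * X * N).toPiLp v) = inner ℂ (N.toPiLp v) (X.toPiLp (N.toPiLp v)) := by
    intro X v
    rw [toPiLp_mul, toPiLp_mul, ← inner_toPiLp_star, hNs]
  have hzero : (N * N * N).toPiLp = 0 := by
    rw [← inner_map_self_eq_zero]
    intro v
    have h1 : 0 ≤ inner ℂ v ((N * N * N).toPiLp v) := by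
      rw [hmid]; exact inner_toPiLp_nonneg hN _
    have h2 : 0 ≤ - inner ℂ v ((N * N * N).toPiLp v) := by
      have h3 := hM (N.toPiLp v)
      rw [← hmid, hNMN] at h3
      simpa [inner_toPiLp] using h3
    rw [← inner_conj_symm, le_antisymm (neg_nonneg.1 h2) h1, map_zero]
  have hzero' : N * N * N = 0 := toPiLp_injective <| by
    rw [hzero]; ext v i; simp [toPiLp_apply]
  -- As N is self-adjoint, (N²)*N² = N³N = 0, and the C*-identity removes one square at a time.
  have hsq : N * N = 0 := by
    rw [← CStarRing.star_mul_self_eq_zero_iff, star_mul, hNs, ← mul_assoc, hzero', zero_mul]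
  have hneg : N = 0 := by
    rw [← CStarRing.star_mul_self_eq_zero_iff, hNs, hsq]
  exact hN0 hneg

end CStarMatrix

end CStarMatrixPositivity

/-! ### Complete positivity as a family of scalar inequalities. -/

section CompletePositivity

variable {H : Type*} [NormedAddCommGroup H] [InnerProductSpace ℂ H] [CompleteSpace H]
variable {K : Type*} [NormedAddCommGroup K] [InnerProductSpace ℂ K] [CompleteSpace K]

/-- A positive matrix X*X has entries ∑ₗ Xₗᵢ* Xₗⱼ, so it is a sum of matrices [aᵢ* aⱼ], one for each
row of X; it suffices to test on these. -/
theorem isCP_iff {ψ : (H →L[ℂ] H) →ₗ[ℂ] (K →L[ℂ] K)} :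
    IsCP ψ ↔ ∀ (n : ℕ) (a : Fin n → H →L[ℂ] H) (f : Fin n → K),
      0 ≤ ∑ i, ∑ j, inner ℂ (f i) (ψ (star (a i) * a j) (f j)) := by
  constructor
  · rintro ⟨Ψ, rfl⟩ n a f
    cases n with
    | zero => simp
    | succ n =>
      -- With a as its only nonzero row, X satisfies X*X = [aᵢ* aⱼ]. The case n = 0 is separate
      -- because this row needs an index.
      let X : CStarMatrix (Fin (n + 1)) (Fin (n + 1)) (H →L[ℂ] H) :=
        CStarMatrix.ofMatrix fun i j => if i = 0 then a j else 0
      have hXa : ∀ l j, X l j = if l = 0 then a j else 0 := fun _ _ => rfl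
      have hX := CStarMatrix.inner_toPiLp_nonneg
        (Ψ.map_cstarMatrix_nonneg' _ (star X * X) (star_mul_self_nonneg X)) (WithLp.toLp 2 f)
      rw [CStarMatrix.inner_toPiLp] at hX
      convert hX using 8 with i _ j _
      rw [CStarMatrix.map_apply, CStarMatrix.mul_apply, Finset.sum_eq_single 0]
      · simp [CStarMatrix.star_apply, hXa]
      · intro l _ hl; simp [CStarMatrix.star_apply, hXa, hl]
      · simp
  · intro hψ
    refine ⟨⟨ψ, fun k M hM => ?_⟩, rfl⟩
    refine CStarMatrix.nonneg_of_inner_toPiLp_nonneg fun v => ?_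
    obtain ⟨X, rfl⟩ := exists_eq_star_mul_self_of_nonneg hM
    rw [CStarMatrix.inner_toPiLp]
    have key : ∑ i, ∑ j, inner ℂ (v i) ((star X * X).map ψ i j (v j)) =
        ∑ l, ∑ i, ∑ j, inner ℂ (v i) (ψ (star (X l i) * X l j) (v j)) := by
      simp only [CStarMatrix.map_apply, CStarMatrix.mul_apply, CStarMatrix.star_apply, map_sum,
        sum_apply, inner_sum]
      exact (Finset.sum_congr rfl fun i _ => Finset.sum_comm).trans Finset.sum_comm
    exact key ▸ Finset.sum_nonneg fun l _ => hψ k (X l) v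

theorem IsCP.sum_inner_nonneg {ψ : (H →L[ℂ] H) →ₗ[ℂ] (K →L[ℂ] K)} (hψ : IsCP ψ)
    {α : Type*} [Fintype α] (a : α → H →L[ℂ] H) (f : α → K) :
    0 ≤ ∑ i, ∑ j, inner ℂ (f i) (ψ (star (a i) * a j) (f j)) := by
  let e := (Fintype.equivFin α).symm
  have h := isCP_iff.1 hψ _ (a ∘ e) (f ∘ e)
  simp only [Function.comp_apply] at h
  rw [e.sum_comp (fun i => ∑ j, inner ℂ (f i) (ψ (star (a i) * a (e j)) (f (e j))))] at h
  convert h using 2 with i _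
  exact (e.sum_comp (fun j => inner ℂ (f i) (ψ (star (a i) * a j) (f j)))).symm

end CompletePositivity

/-! ### Continuity of ω through its spectral resolution. -/

section SpectralResolutionLemmas

open ContinuousLinearMap

variable {E : Type*} [NormedAddCommGroup E] [InnerProductSpace ℂ E] [CompleteSpace E]
variable {ω : (E →L[ℂ] E) →ₗ[ℂ] ℂ} {ι : Type*}

/-- Self-adjointness of the density is not a field of the structure; it is recovered from real
eigenvalues on a complete orthonormal system. -/
theorem SpectralResolution.inner_basis_density (R : SpectralResolution ω ι) (i : ι) (v : E) :
    inner ℂ (R.basis i) (R.density v) = R.eigenvalue i * inner ℂ (R.basis i) v := by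
  have h : adjoint R.density (R.basis i) = (R.eigenvalue i : ℂ) • R.basis i := by
    refine R.basis.repr.injective (lp.ext (funext fun j => ?_))
    rw [HilbertBasis.repr_apply_apply, HilbertBasis.repr_apply_apply, adjoint_inner_right,
      R.density_basis, inner_smul_left, inner_smul_right, Complex.conj_ofReal]
    by_cases hij : j = i
    · rw [hij]
    · rw [R.basis.orthonormal.2 hij, mul_zero, mul_zero]
  rw [← adjoint_inner_left, h, inner_smul_left, Complex.conj_ofReal]

theorem SpectralResolution.hasSum_inner (R : SpectralResolution ω ι) (a : E →L[ℂ] E) :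
    HasSum (fun i => (R.eigenvalue i : ℂ) * inner ℂ (R.basis i) (a (R.basis i))) (ω a) := by
  simpa only [R.inner_basis_density] using R.hasSum_trace a

/-- Bounded weak operator convergence passes through ω: in ω(A) = ∑ λᵢ⟨eᵢ, A eᵢ⟩ the terms are
dominated by the summable λᵢC. -/
theorem SpectralResolution.tendsto (R : SpectralResolution ω ι) {α : Type*} {l : Filter α}
    {A : α → E →L[ℂ] E} {a : E →L[ℂ] E} {C : ℝ} (hC : ∀ s, ‖A s‖ ≤ C)
    (hA : ∀ v, Filter.Tendsto (fun s => inner ℂ v (A s v)) l (nhds (inner ℂ v (a v)))) :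
    Filter.Tendsto (fun s => ω (A s)) l (nhds (ω a)) := by
  rw [← (R.hasSum_inner a).tsum_eq]
  simp_rw [← (R.hasSum_inner (A _)).tsum_eq]
  refine tendsto_tsum_of_dominated_convergence (R.hasSum_eigenvalue.summable.mul_right C)
    (fun i => (hA (R.basis i)).const_mul _) (Filter.Eventually.of_forall fun s i => ?_)
  rw [norm_mul, Complex.norm_real, Real.norm_of_nonneg (R.eigenvalue_nonneg i)]
  refine mul_le_mul_of_nonneg_left ((norm_inner_le_norm _ _).trans ?_) (R.eigenvalue_nonneg i)
  have h := (A s).le_opNorm (R.basis i)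
  rw [R.basis.orthonormal.1 i, mul_one] at h
  rw [R.basis.orthonormal.1 i, one_mul]
  exact h.trans (hC s)

end SpectralResolutionLemmas

/-! ### Duality between φ* and ω; co-CP always, and CP from PPT. -/

section EntanglementMapping

open ContinuousLinearMap InnerProductSpace

variable {H : Type*} [NormedAddCommGroup H] [InnerProductSpace ℂ H] [CompleteSpace H]
variable {K : Type*} [NormedAddCommGroup K] [InnerProductSpace ℂ K] [CompleteSpace K]
variable {ω : (HilbertTensor H K →L[ℂ] HilbertTensor H K) →ₗ[ℂ] ℂ} {ι κ τ : Type*}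

theorem adjoint_entanglingOperator_tensorLeft (R : SpectralResolution ω ι)
    (h : HilbertBasis κ ℂ H) (i : ι) (g : K) :
    adjoint (entanglingOperator R h) (tensorLeft K (R.basis i) g) =
      (Real.sqrt (R.eigenvalue i) : ℂ) •
        conjugation h (adjoint (tensorRight H g) (R.basis i)) := by
  refine ext_inner_right ℂ fun ζ => ?_
  rw [adjoint_inner_left, ← adjoint_inner_right, adjoint_tensorLeft_entanglingOperator,
    inner_smul_right, inner_smul_left, Complex.conj_ofReal, inner_conjugation_left,
    adjoint_inner_right, adjoint_inner_right, tensorRight_apply]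

/-- The entanglement mapping is characterized by `Tr (φ*(a) b) = ω (a ⊗ b)`, stated here for
operators `b` of rank one. -/
theorem inner_entanglementMapping (R : SpectralResolution ω ι) (h : HilbertBasis κ ℂ H)
    (a : H →L[ℂ] H) (g f : K) :
    inner ℂ g (entanglementMapping R h a f) = ω (tensorOp a (rankOne ℂ f g)) := by
  have h1 := ((summable_partialTrace R h (transposition h a)).hasSum.mapL
    (ContinuousLinearMap.apply ℂ K f)).mapL (innerSL ℂ g)
  refine HasSum.unique h1 ?_
  refine (R.hasSum_inner (tensorOp a (rankOne ℂ f g))).congr_fun fun i => ?_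
  change inner ℂ g (adjoint (tensorLeft K (R.basis i)) (entanglingOperator R h
    (transposition h a (adjoint (entanglingOperator R h) (tensorLeft K (R.basis i) f))))) = _
  -- The conjugation produced by V* on the right cancels one in aᵗ = Ja*J, and the two remaining
  -- ones interchange the arguments of the inner product, so that a* moves across as a.
  rw [adjoint_inner_right, ← adjoint_inner_left, adjoint_entanglingOperator_tensorLeft,
    adjoint_entanglingOperator_tensorLeft, map_smul, inner_smul_left, inner_smul_right,
    Complex.conj_ofReal, ← mul_assoc, ← Complex.ofReal_mul,
    Real.mul_self_sqrt (R.eigenvalue_nonneg i), transposition_apply, conjugation_conjugation,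
    inner_conjugation_conjugation, adjoint_inner_left, adjoint_inner_left, tensorOp_rankOne]
  rfl

/-- The sum is ω(XX*) for X = ∑ cⱼ ⊗ |fⱼ⟩⟨u| with any unit vector u; the zero space, which has no
unit vector, is treated apart. -/
theorem IsState.sum_tensorOp_rankOne_nonneg (hω : IsState ω) {α : Type*} [Fintype α]
    (c : α → H →L[ℂ] H) (f : α → K) :
    0 ≤ ∑ i, ∑ j, ω (tensorOp (c j * star (c i)) (rankOne ℂ (f j) (f i))) := by
  rcases subsingleton_or_nontrivial K with hK | hK
  · have hf : ∀ i, f i = 0 := fun i => Subsingleton.elim _ _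
    have h0 : ∀ a : H →L[ℂ] H, tensorOp a (0 : K →L[ℂ] K) = 0 := fun a => by
      simpa using tensorOp_smul_right 0 a (0 : K →L[ℂ] K)
    simp [hf, h0]
  · obtain ⟨u, hu⟩ := exists_norm_eq K zero_le_one
    let X := ∑ j, tensorOp (c j) (rankOne ℂ (f j) u)
    have hX : X * star X =
        ∑ i, ∑ j, tensorOp (c j * star (c i)) (rankOne ℂ (f j) (f i)) := by
      have hs : star X = ∑ i, tensorOp (star (c i)) (rankOne ℂ u (f i)) := by
        rw [star_eq_adjoint, map_sum]
        refine Finset.sum_congr rfl fun i _ => ?_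
        rw [← star_eq_adjoint, star_tensorOp, star_eq_adjoint (rankOne ℂ (f i) u), adjoint_rankOne]
      rw [hs, Finset.sum_mul_sum, Finset.sum_comm]
      refine Finset.sum_congr rfl fun i _ => Finset.sum_congr rfl fun j _ => ?_
      rw [tensorOp_mul, mul_def (rankOne ℂ (f j) u), rankOne_comp_rankOne,
        inner_self_eq_norm_sq_to_K, hu]
      simp
    simp_rw [← map_sum]
    rw [← hX]
    exact hω.map_nonneg _ (mul_star_self_nonneg X)

/-- Transposition reverses products: (aᵢ* aⱼ)ᵗ = aⱼᵗ (aᵢᵗ)*, which is exactly the order of factors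
occurring in XX*. -/
theorem isCoCP_entanglementMapping (hω : IsState ω) (R : SpectralResolution ω ι)
    (h : HilbertBasis κ ℂ H) (t : HilbertBasis τ ℂ H) :
    IsCoCP t (entanglementMapping R h) := by
  refine isCP_iff.2 fun n a f => ?_
  simpa only [LinearMap.comp_apply, inner_entanglementMapping, transposition_mul,
    transposition_star] using
    hω.sum_tensorOp_rankOne_nonneg (fun i => transposition t (a i)) f

/-- The argument for co-CP applies to ω', and the transposition relating ω' to ω undoes the one in
co-CP. -/
theorem IsPPT.isCP_entanglementMapping {t : HilbertBasis τ ℂ H} (hω : IsPPT t ω)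
    (R : SpectralResolution ω ι) (h : HilbertBasis κ ℂ H) : IsCP (entanglementMapping R h) := by
  obtain ⟨-, ω', hω', hωω'⟩ := hω
  refine isCP_iff.2 fun n a f => ?_
  have := hω'.sum_tensorOp_rankOne_nonneg (fun i => transposition t (a i)) f
  simpa only [hωω', ← transposition_star, ← transposition_mul, transposition_transposition,
    ← inner_entanglementMapping R h] using this

end EntanglementMapping

/-! ### Finite rank projections and their strong convergence to the identity. -/

section FiniteRankProjections

open ContinuousLinearMap InnerProductSpace

variable {E : Type*} [NormedAddCommGroup E] [InnerProductSpace ℂ E]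

/-- The orthogonal projection onto the span of finitely many vectors of a complete orthonormal
system. -/
def HilbertBasis.finsetProj {ι : Type*} (e : HilbertBasis ι ℂ E) (s : Finset ι) : E →L[ℂ] E :=
  ∑ i ∈ s, rankOne ℂ (e i) (e i)

theorem HilbertBasis.tendsto_finsetProj {ι : Type*} (e : HilbertBasis ι ℂ E) (v : E) :
    Filter.Tendsto (fun s => e.finsetProj s v) Filter.atTop (nhds v) := by
  have h := e.hasSum_repr v
  simp only [HilbertBasis.repr_apply_apply] at h
  simpa only [HasSum, SummationFilter.unconditional_filter, finsetProj, sum_apply,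
    rankOne_apply] using h

variable [CompleteSpace E]

theorem HilbertBasis.isStarProjection_finsetProj {ι : Type*} (e : HilbertBasis ι ℂ E)
    (s : Finset ι) : IsStarProjection (e.finsetProj s) := by
  classical
  refine ⟨?_, ?_⟩
  · rw [IsIdempotentElem, finsetProj, Finset.sum_mul_sum]
    refine Finset.sum_congr rfl fun i hi => ?_
    rw [Finset.sum_eq_single i]
    · exact isIdempotentElem_rankOne_self (e.orthonormal.1 i)
    · intro j _ hj
      rw [mul_def, rankOne_comp_rankOne, e.orthonormal.2 hj.symm, zero_smul]
    · exact fun h => absurd hi h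
  · rw [IsSelfAdjoint, finsetProj, star_eq_adjoint, map_sum]
    exact Finset.sum_congr rfl fun i _ => adjoint_rankOne _ _

open Filter Topology in
theorem SpectralResolution.tendsto_comp_finsetProj_comp
    {ω : (E →L[ℂ] E) →ₗ[ℂ] ℂ} {ι : Type*} (R : SpectralResolution ω ι)
    (x y : E →L[ℂ] E) :
    Tendsto (fun s => ω (x * R.basis.finsetProj s * y)) atTop (𝓝 (ω (x * y))) := by
  refine R.tendsto (C := ‖x‖ * ‖y‖) (fun s => ?_) fun v => ?_
  · have h1 := IsStarProjection.norm_le _ (R.basis.isStarProjection_finsetProj s)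
    refine (norm_mul_le _ _).trans (mul_le_mul_of_nonneg_right ?_ (norm_nonneg _))
    exact (norm_mul_le _ _).trans (mul_le_of_le_one_right (norm_nonneg _) h1)
  · exact tendsto_const_nhds.inner ((x.continuous.tendsto _).comp
      (R.basis.tendsto_finsetProj (y v)))

end FiniteRankProjections

section TensorProjections

open ContinuousLinearMap InnerProductSpace

variable {E : Type*} [NormedAddCommGroup E] [InnerProductSpace ℂ E] [CompleteSpace E]
variable {F : Type*} [NormedAddCommGroup F] [InnerProductSpace ℂ F] [CompleteSpace F]

theorem isStarProjection_tensorOp_one {p : E →L[ℂ] E} (hp : IsStarProjection p) :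
    IsStarProjection (tensorOp p (1 : F →L[ℂ] F)) :=
  ⟨by rw [IsIdempotentElem, tensorOp_mul, hp.isIdempotentElem.eq, one_mul],
    by rw [IsSelfAdjoint, star_tensorOp, hp.isSelfAdjoint.star_eq, star_one]⟩

theorem tendsto_tensorOp_finsetProj_one {ι : Type*} (e : HilbertBasis ι ℂ E)
    (z : HilbertTensor E F) :
    Filter.Tendsto (fun s => tensorOp (e.finsetProj s) (1 : F →L[ℂ] F) z) Filter.atTop
      (nhds z) := by
  refine HilbertTensor.induction (p := fun z =>
    Filter.Tendsto (fun s => tensorOp (e.finsetProj s) (1 : F →L[ℂ] F) z) Filter.atTop (nhds z))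
    ?_ (fun y z hy hz => by simpa only [map_add] using hy.add hz) (fun x f => ?_) z
  -- The projections are contractions, hence equicontinuous, so the set of vectors where they
  -- converge to the identity is closed.
  · have hL : ∀ s, LipschitzWith 1 (tensorOp (e.finsetProj s) (1 : F →L[ℂ] F)) := fun s =>
      (tensorOp (e.finsetProj s) (1 : F →L[ℂ] F)).lipschitz.weaken
        (IsStarProjection.norm_le _
          (isStarProjection_tensorOp_one (e.isStarProjection_finsetProj s)))
    exact (LipschitzWith.uniformEquicontinuous _ 1 hL).equicontinuous.isClosed_setOfPred_tendsto
      continuous_id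
  · simp only [tensorOp_tensorLeft, one_apply_eq_self]
    exact ((tensorRight E f).continuous.tendsto x).comp (e.tendsto_finsetProj x)

end TensorProjections

/-! ### Bounds for positive functionals and weak-* compactness. -/

section LimitsOfStates

open Filter Topology

variable {E : Type*} [NormedAddCommGroup E] [InnerProductSpace ℂ E] [CompleteSpace E]

/-- Apply θ to -‖a‖1 ≤ a ≤ ‖a‖1. -/
theorem norm_apply_le_of_isSelfAdjoint {θ : (E →L[ℂ] E) →ₗ[ℂ] ℂ} (hθ : ∀ a, 0 ≤ a → 0 ≤ θ a)
    {a : E →L[ℂ] E} (ha : IsSelfAdjoint a) : ‖θ a‖ ≤ ‖a‖ * ‖θ 1‖ := by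
  have hr : ∀ r : ℝ, θ (algebraMap ℝ (E →L[ℂ] E) r) = r * θ 1 := fun r => by
    rw [Algebra.algebraMap_eq_smul_one, ← Complex.coe_smul, map_smul, smul_eq_mul]
  have h0 := Complex.nonneg_iff.1 (hθ 1 zero_le_one)
  have h1 := hθ _ (sub_nonneg.2 ha.le_algebraMap_norm_self)
  have h2 := hθ _ (sub_nonneg.2 ha.neg_algebraMap_norm_le_self)
  rw [map_sub, hr, Complex.nonneg_iff] at h1
  rw [map_sub, map_neg, hr, Complex.nonneg_iff] at h2
  simp only [Complex.sub_re, Complex.sub_im, Complex.neg_re, Complex.re_ofReal_mul,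
    Complex.im_ofReal_mul, ← h0.2, mul_zero] at h1 h2
  have him : (θ a).im = 0 := by linarith [h1.2]
  have hn : ‖θ 1‖ = (θ 1).re := by
    rw [← Complex.abs_re_eq_norm.2 h0.2.symm, abs_of_nonneg h0.1]
  rw [hn, ← Complex.abs_re_eq_norm.2 him, abs_le]
  exact ⟨by linarith [h2.1], by linarith [h1.1]⟩

/-- The factor 2 comes from adding the real and imaginary parts; it is not sharp, but any bound
suffices for compactness. -/
theorem norm_apply_le_of_nonneg {θ : (E →L[ℂ] E) →ₗ[ℂ] ℂ} (hθ : ∀ a, 0 ≤ a → 0 ≤ θ a)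
    (a : E →L[ℂ] E) : ‖θ a‖ ≤ 2 * ‖a‖ * ‖θ 1‖ := by
  have h1 := norm_apply_le_of_isSelfAdjoint hθ (realPart a).2
  have h2 := norm_apply_le_of_isSelfAdjoint hθ (imaginaryPart a).2
  have h3 : ‖(realPart a : E →L[ℂ] E)‖ ≤ ‖a‖ := realPart.norm_le a
  have h4 : ‖(imaginaryPart a : E →L[ℂ] E)‖ ≤ ‖a‖ := imaginaryPart.norm_le a
  have h5 : ‖θ a‖ ≤ ‖θ (realPart a)‖ + ‖θ (imaginaryPart a)‖ := by
    conv_lhs => rw [← realPart_add_I_smul_imaginaryPart a, map_add, map_smul]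
    refine (norm_add_le _ _).trans ?_
    rw [norm_smul, Complex.norm_I, one_mul]
  nlinarith [norm_nonneg (θ 1)]

/-- Weak-* compactness of the state space: a net of positive functionals, asymptotically
normalized, has a state as a cluster point. -/
theorem exists_isState_of_tendsto {α : Type*} {l : Filter α} [l.NeBot]
    {θ : α → (E →L[ℂ] E) →ₗ[ℂ] ℂ} (hθ : ∀ s a, 0 ≤ a → 0 ≤ θ s a)
    (hone : Tendsto (fun s => θ s 1) l (𝓝 1)) :
    ∃ ω : (E →L[ℂ] E) →ₗ[ℂ] ℂ, IsState ω ∧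
      ∀ a c, Tendsto (fun s => θ s a) l (𝓝 c) → ω a = c := by
  -- Along an ultrafilter all the bounded families θ s a converge at once, so the limit is linear by
  -- uniqueness of limits and agrees with every limit already existing along l.
  let U : Ultrafilter α := Ultrafilter.of l
  have hU : (U : Filter α) ≤ l := Ultrafilter.of_le l
  have hb : ∀ᶠ s in l, ‖θ s 1‖ ≤ 2 :=
    (hone.norm.eventually_lt_const (by simp : ‖(1 : ℂ)‖ < 2)).mono fun _ h => h.le
  have hlim : ∀ a, ∃ c, Tendsto (fun s => θ s a) U (𝓝 c) := fun a => by
    obtain ⟨c, -, hc⟩ := (isCompact_closedBall (0 : ℂ) (2 * ‖a‖ * 2)).ultrafilter_le_nhds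
      (U.map fun s => θ s a) (le_principal_iff.2 ((hb.filter_mono hU).mono fun s hs => by
        change θ s a ∈ _
        rw [mem_closedBall_zero_iff]
        exact (norm_apply_le_of_nonneg (hθ s) a).trans (by gcongr)))
    exact ⟨c, hc⟩
  choose L hL using hlim
  refine ⟨⟨⟨L, fun a b => ?_⟩, fun c a => ?_⟩, ⟨?_, fun a ha => ?_⟩, fun a c h => ?_⟩
  · refine tendsto_nhds_unique (hL _) ?_
    simpa only [map_add] using (hL a).add (hL b)
  · refine tendsto_nhds_unique (hL _) ?_
    simpa only [map_smul, RingHom.id_apply] using (hL a).const_smul c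
  · exact tendsto_nhds_unique (hL 1) (hone.mono_left hU)
  · exact ge_of_tendsto' (hL a) fun s => hθ s a ha
  · exact tendsto_nhds_unique (hL a) (h.mono_left hU)

end LimitsOfStates

/-! ### From CP to PPT by partial transposition of compressions. -/

section PartialTranspose

open ContinuousLinearMap InnerProductSpace Filter Topology

variable {H : Type*} [NormedAddCommGroup H] [InnerProductSpace ℂ H]
variable {K : Type*} [NormedAddCommGroup K] [InnerProductSpace ℂ K] [CompleteSpace K]
variable {ω : (HilbertTensor H K →L[ℂ] HilbertTensor H K) →ₗ[ℂ] ℂ} {ι κ τ : Type*}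

/-- The partial transposition of the compression of an operator on `H ⊗ K` to the span of the
vectors `t i ⊗ f`, `i ∈ s`. -/
def partialTranspose (t : HilbertBasis τ ℂ H) (s : Finset τ) :
    (HilbertTensor H K →L[ℂ] HilbertTensor H K) →ₗ[ℂ]
      (HilbertTensor H K →L[ℂ] HilbertTensor H K) where
  toFun x := ∑ i : s, ∑ j : s, tensorOp (rankOne ℂ (t j) (t i))
    (adjoint (tensorLeft K (t i)) ∘L x ∘L tensorLeft K (t j))
  map_add' x y := by
    simp only [add_comp, comp_add, tensorOp_add_right, Finset.sum_add_distrib]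
  map_smul' c x := by
    simp only [smul_comp, comp_smul, tensorOp_smul_right, Finset.smul_sum, RingHom.id_apply]

theorem partialTranspose_apply (t : HilbertBasis τ ℂ H) (s : Finset τ)
    (x : HilbertTensor H K →L[ℂ] HilbertTensor H K) :
    partialTranspose t s x = ∑ i : s, ∑ j : s, tensorOp (rankOne ℂ (t j) (t i))
      (adjoint (tensorLeft K (t i)) ∘L x ∘L tensorLeft K (t j)) := rfl

theorem finsetProj_mul_mul_finsetProj (t : HilbertBasis τ ℂ H) (s : Finset τ) (a : H →L[ℂ] H) :
    t.finsetProj s * a * t.finsetProj s =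
      ∑ i : s, ∑ j : s, inner ℂ (t i) (a (t j)) • rankOne ℂ (t i) (t j) := by
  rw [HilbertBasis.finsetProj, ← Finset.sum_coe_sort s, Finset.sum_mul, Finset.sum_mul_sum]
  refine Finset.sum_congr rfl fun i _ => Finset.sum_congr rfl fun j _ => ?_
  rw [mul_assoc, mul_def, mul_def, comp_rankOne, rankOne_comp_rankOne]

variable [CompleteSpace H]

/-- The vectors of t are fixed by its conjugation, so ⟨tⱼ, aᵗ tᵢ⟩ = ⟨tᵢ, a tⱼ⟩: interchanging matrix
indices is transposing. -/
theorem partialTranspose_tensorOp (t : HilbertBasis τ ℂ H) (s : Finset τ) (a : H →L[ℂ] H)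
    (b : K →L[ℂ] K) :
    partialTranspose t s (tensorOp a b) = tensorOp (t.finsetProj s) 1 *
      tensorOp (transposition t a) b * tensorOp (t.finsetProj s) 1 := by
  rw [tensorOp_mul, tensorOp_mul, one_mul, mul_one, finsetProj_mul_mul_finsetProj,
    partialTranspose_apply, tensorOp_sum_left, Finset.sum_comm]
  refine Finset.sum_congr rfl fun i _ => ?_
  rw [tensorOp_sum_left]
  refine Finset.sum_congr rfl fun j _ => ?_
  rw [adjoint_tensorLeft_tensorOp_tensorLeft, tensorOp_smul_right, tensorOp_smul_left,
    transposition_apply, inner_conjugation_right, conjugation_basis, conjugation_basis,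
    adjoint_inner_left]

theorem SpectralResolution.tendsto_compress (R : SpectralResolution ω ι) (t : HilbertBasis τ ℂ H)
    (x : HilbertTensor H K →L[ℂ] HilbertTensor H K) :
    Tendsto (fun s => ω (tensorOp (t.finsetProj s) 1 * x * tensorOp (t.finsetProj s) 1)) atTop
      (𝓝 (ω x)) := by
  have hp : ∀ s, IsStarProjection (tensorOp (t.finsetProj s) (1 : K →L[ℂ] K)) := fun s =>
    isStarProjection_tensorOp_one (t.isStarProjection_finsetProj s)
  refine R.tendsto (C := ‖x‖) (fun s => ?_) fun v => ?_
  · have h1 := IsStarProjection.norm_le (tensorOp (t.finsetProj s) (1 : K →L[ℂ] K)) (hp s)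
    refine (norm_mul_le _ _).trans ((mul_le_of_le_one_right (norm_nonneg _) h1).trans ?_)
    exact (norm_mul_le _ _).trans (mul_le_of_le_one_left (norm_nonneg _) h1)
  · have h2 := tendsto_tensorOp_finsetProj_one (F := K) t v
    refine (h2.inner ((x.continuous.tendsto v).comp h2)).congr fun s => ?_
    rw [mul_apply_eq_comp, mul_apply_eq_comp, ← adjoint_inner_left, ← star_eq_adjoint,
      (hp s).isSelfAdjoint.star_eq]
    rfl

/-- Test CP on aᵢ = |u⟩⟨eᵢ| with u a unit vector. For e from the system t, the operator under ω is
the partial transpose of |z⟩⟨z| with z = ∑ eᵢ ⊗ fᵢ. -/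
theorem IsCP.sum_rankOne_nonneg {R : SpectralResolution ω ι} {h : HilbertBasis κ ℂ H}
    (hφ : IsCP (entanglementMapping R h)) {α : Type*} [Fintype α] (e : α → H) (f : α → K) :
    0 ≤ ∑ i, ∑ j, ω (tensorOp (rankOne ℂ (e j) (e i)) (rankOne ℂ (f i) (f j))) := by
  rcases subsingleton_or_nontrivial H with hH | hH
  · have he : ∀ i, e i = 0 := fun i => Subsingleton.elim _ _
    have h0 : ∀ b : K →L[ℂ] K, tensorOp (0 : H →L[ℂ] H) b = 0 := fun b => by
      simpa using tensorOp_smul_left 0 (0 : H →L[ℂ] H) b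
    simp [he, h0]
  · obtain ⟨u, hu⟩ := exists_norm_eq H zero_le_one
    rw [Finset.sum_comm]
    have := hφ.sum_inner_nonneg (fun i => rankOne ℂ u (e i)) f
    convert this using 4 with i _ j _
    rw [inner_entanglementMapping, star_eq_adjoint, adjoint_rankOne, mul_def,
      rankOne_comp_rankOne, inner_self_eq_norm_sq_to_K, hu]
    simp

/-- For x = y*y, inserting a finite rank projection gives y*Py = ∑ₘ |y*eₘ⟩⟨y*eₘ|, a sum of rank one
operators covered by `IsCP.sum_rankOne_nonneg`; then P increases to 1. -/
theorem IsCP.partialTranspose_nonneg {R : SpectralResolution ω ι} {h : HilbertBasis κ ℂ H}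
    (hφ : IsCP (entanglementMapping R h)) (t : HilbertBasis τ ℂ H) (s : Finset τ)
    {x : HilbertTensor H K →L[ℂ] HilbertTensor H K} (hx : 0 ≤ x) :
    0 ≤ ω (partialTranspose t s x) := by
  obtain ⟨y, rfl⟩ := exists_eq_star_mul_self_of_nonneg (A := HilbertTensor H K →L[ℂ] HilbertTensor H K) hx
  have hlim : Tendsto (fun u => ω (partialTranspose t s (star y * R.basis.finsetProj u * y)))
      atTop (𝓝 (ω (partialTranspose t s (star y * y)))) := by
    simp only [partialTranspose_apply, map_sum]
    refine tendsto_finsetSum _ fun i _ => tendsto_finsetSum _ fun j _ => ?_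
    -- Each of the finitely many terms is ω of a fixed operator times y*Py times a fixed operator,
    -- so continuity of ω applies termwise.
    simp only [tensorOp_rankOne_left]
    exact R.tendsto_comp_finsetProj_comp
      ((tensorLeft K (t j) ∘L adjoint (tensorLeft K (t i))) * star y)
      (y * (tensorLeft K (t j) ∘L adjoint (tensorLeft K (t i))))
  refine ge_of_tendsto' hlim fun u => ?_
  rw [HilbertBasis.finsetProj, Finset.mul_sum, Finset.sum_mul, map_sum, map_sum]
  refine Finset.sum_nonneg fun m _ => ?_
  have := hφ.sum_rankOne_nonneg (fun i : s => t i)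
    (fun i : s => adjoint (tensorLeft K (t i)) (star y (R.basis m)))
  simp only [partialTranspose_apply, map_sum]
  convert this using 6 with i _ j _
  rw [mul_def, mul_def, comp_rankOne, rankOne_comp, rankOne_comp, comp_rankOne, star_eq_adjoint]

/-- PPT asks only for a state ω', not a normal one, so a weak-* cluster point is enough. The
approximants are normalized only in the limit, by convergence at 1 ⊗ 1. -/
theorem IsCP.isPPT {R : SpectralResolution ω ι} {h : HilbertBasis κ ℂ H}
    (hφ : IsCP (entanglementMapping R h)) (hω : IsState ω) (t : HilbertBasis τ ℂ H) :
    IsPPT t ω := by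
  have hlim : ∀ a b, Tendsto (fun s => (ω ∘ₗ partialTranspose t s) (tensorOp a b)) atTop
      (𝓝 (ω (tensorOp (transposition t a) b))) := fun a b => by
    simpa only [LinearMap.comp_apply, partialTranspose_tensorOp] using
      R.tendsto_compress t (tensorOp (transposition t a) b)
  have ht1 : transposition t 1 = 1 := by
    ext f
    rw [transposition_apply, ← star_eq_adjoint, star_one, one_apply_eq_self, one_apply_eq_self,
      conjugation_conjugation]
  have hone := hlim 1 1
  rw [ht1, tensorOp_one, hω.map_one] at hone
  obtain ⟨ω', hω', h'⟩ := exists_isState_of_tendsto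
    (fun s a ha => hφ.partialTranspose_nonneg t s ha) hone
  exact ⟨hω, ω', hω', fun a b => h' _ _ (hlim a b)⟩

end PartialTranspose

/-! ### The two equivalences. -/

section Main

variable {H : Type u} [NormedAddCommGroup H] [InnerProductSpace ℂ H] [CompleteSpace H]
variable {K : Type v} [NormedAddCommGroup K] [InnerProductSpace ℂ K] [CompleteSpace K]
variable {ω : (HilbertTensor H K →L[ℂ] HilbertTensor H K) →ₗ[ℂ] ℂ} {ι : Type w} {κ : Type x}

theorem isPPT_iff_isCP {τ : Type*} (t : HilbertBasis τ ℂ H) (hω : IsState ω)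
    (R : SpectralResolution ω ι) (h : HilbertBasis κ ℂ H) :
    IsPPT t ω ↔ IsCP (entanglementMapping R h) :=
  ⟨fun hP => hP.isCP_entanglementMapping R h, fun hC => hC.isPPT hω t⟩

/-- Normality serves only to make φ* an entanglement mapping, so that lying outside ℰ_q must mean
being CP; the limit arguments use the spectral resolution instead. -/
theorem notMem_qEntanglements_iff_isCP (hω : IsNormalState ω)
    (R : SpectralResolution ω ι) (h : HilbertBasis κ ℂ H) :
    entanglementMapping R h ∉ qEntanglements.{u, v, w, x} H K ↔
      IsCP (entanglementMapping R h) := by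
  have hmem : entanglementMapping R h ∈ entanglementMappings.{u, v, w, x} H K :=
    ⟨ω, hω, ι, R, κ, h, rfl⟩
  change ¬ (_ ∧ ¬ _) ↔ _
  rw [not_and, not_not]
  exact ⟨fun hC => hC hmem, fun hC _ => hC⟩

end Main

end

theorem mainTheorem1 {H : Type u} [NormedAddCommGroup H] [InnerProductSpace ℂ H]
    [CompleteSpace H] [TopologicalSpace.SeparableSpace H]
    {K : Type v} [NormedAddCommGroup K] [InnerProductSpace ℂ K]
    [CompleteSpace K] [TopologicalSpace.SeparableSpace K]
    {τ : Type y} (t : HilbertBasis τ ℂ H)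
    (ω : (HilbertTensor H K →L[ℂ] HilbertTensor H K) →ₗ[ℂ] ℂ) (hω : IsNormalState ω)
    {ι : Type w} (R : SpectralResolution ω ι) {κ : Type x} (h : HilbertBasis κ ℂ H) :
    (IsPPT t ω ↔ IsCP (entanglementMapping R h) ∧ IsCoCP t (entanglementMapping R h)) ∧
    (IsPPT t ω ↔ entanglementMapping R h ∉ qEntanglements.{u, v, w, x} H K) := by
  rw [notMem_qEntanglements_iff_isCP hω, isPPT_iff_isCP t hω.toIsState R h]
  exact ⟨⟨fun hC => ⟨hC, isCoCP_entanglementMapping hω.toIsState R h t⟩, And.left⟩, Iff.rfl⟩
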